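/- Let $(a_i)_{i\ge 1}$ be a non-decreasing sequence of nonzero real numbers with $\sum_{i} a_i^{-2}<\infty$, let $(x_i)_{i\ge1}$ be independent $\mathcal N(0,1)$ random variables, let $z=\sum_{i\ge1} x_i^2/a_i^2$ (the series converges almost surely), and let $F(s)=\mathbb P(z<s)$ for $s\in\mathbb R$. Let $\mu(\theta)=\sum_{i\ge1}\frac{1}{a_i^2+2\theta}$ for $\theta\ge0$, let $\mu^{-1}(s)=\inf\{\theta\ge0:\mu(\theta)\le s\}\in[0,\infty]$ be its generalized inverse ($\inf\emptyset=\infty$), and let $\rho=1/\mu^{-1}$ (with $1/\infty=0$). Then $F$ belongs to de Haan's class $\Gamma_0$ at zero, with auxiliary function $\rho$. That is: $F:\mathbb R\to[0,\infty)$ is null on $(-\infty,0]$, non-decreasing and right-continuous; on some right-neighbourhood $[0,\delta)$ of zero, $\delta>0$, the function $\rho$ is finite, nonnegative, continuous and non-decreasing, with $\rho(0)=0$; and for every $x\in\mathbb R$, $$\lim_{s\downarrow 0}\frac{F(s+x\rho(s))}{F(s)}=e^{x}.$$ -/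

import Mathlib

open MeasureTheory ProbabilityTheory Filter Topology Set
open scoped NNReal ENNReal

noncomputable section

namespace SmallBall

/-- `ρ`, considered on some right-neighbourhood `[0, δ)` of zero, is an auxiliary function of `F`:
it is nonnegative, continuous and non-decreasing there, vanishes at `0`, and
`F (s + x ρ(s)) / F s → exp x` as `s ↓ 0`, for every real `x`. -/
structure IsAuxiliaryFunction (F ρ : ℝ → ℝ) : Prop where
  regular : ∃ δ : ℝ, 0 < δ ∧ (∀ s ∈ Ico 0 δ, 0 ≤ ρ s) ∧
    ContinuousOn ρ (Ico 0 δ) ∧ MonotoneOn ρ (Ico 0 δ)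
  map_zero : ρ 0 = 0
  tendsto_div : ∀ x : ℝ,
    Tendsto (fun s : ℝ => F (s + x * ρ s) / F s) (𝓝[>] 0) (𝓝 (Real.exp x))

/-- De Haan's class `Γ₀` at zero: the nonnegative, non-decreasing, right-continuous functions
that are null on `(-∞, 0]` and possess an auxiliary function. -/
structure IsGammaZero (F : ℝ → ℝ) : Prop where
  nonneg : ∀ s, 0 ≤ F s
  null : ∀ s ≤ 0, F s = 0
  mono : Monotone F
  right_continuous : ∀ s, ContinuousWithinAt F (Ici s) s
  exists_auxiliary : ∃ ρ : ℝ → ℝ, IsAuxiliaryFunction F ρ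

/-- `μ(θ) = ∑ 1 / (a_i² + 2θ)`, to be used for `θ ≥ 0`. -/
def mu (a : ℕ → ℝ) (θ : ℝ) : ℝ := ∑' i, 1 / (a i ^ 2 + 2 * θ)

/-- The generalized inverse of a non-increasing function `f` on `[0, ∞)`:
`s ↦ inf {θ ≥ 0 : f θ ≤ s}`, with values in `[0, ∞]` (so `inf ∅ = ∞`). -/
def genInv (f : ℝ → ℝ) (s : ℝ) : ℝ≥0∞ := ⨅ (θ : ℝ≥0) (_ : f θ ≤ s), (θ : ℝ≥0∞)

/-- `ρ = 1 / μ⁻¹`, with `1 / ∞ = 0`. It is meaningful for `s < μ(0)`, where `μ⁻¹(s) > 0`. -/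
def rho (a : ℕ → ℝ) (s : ℝ) : ℝ := ((genInv (mu a) s)⁻¹).toReal

/-- The series `z = ∑ x_i² / a_i²`. -/
def z {Ω : Type*} (a : ℕ → ℝ) (x : ℕ → Ω → ℝ) (ω : Ω) : ℝ := ∑' i, x i ω ^ 2 / a i ^ 2

/-- The small ball function `s ↦ P(z < s)`. -/
def smallBall {Ω : Type*} [MeasurableSpace Ω] (P : Measure Ω) (a : ℕ → ℝ) (x : ℕ → Ω → ℝ)
    (s : ℝ) : ℝ := P.real {ω | z a x ω < s}

end SmallBall

end

/-!
The proof is a saddle point argument. Let `L(θ) = E exp (-θ z) = ∏ (1 + 2θ / a_i²)^(-1/2)` and tilt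
the probability `P` by `exp (-θ z) / L(θ)`. Under the tilted measure `z` has mean
`-L'(θ) / L(θ) = μ(θ)`, so `θ = μ⁻¹(s) = 1 / ρ(s)` is the parameter that makes `s` the mean of `z`.
In terms of the variable `T = θ (z - s)`, undoing the tilt gives
`P (z < s + y / θ) = L(θ) exp (θ s) E_θ [exp T; T < y]` (`smallBall_eq_setIntegral_tiltedLaw`),
and since `1 / θ = ρ(s)` the ratio to be studied is `E_θ [exp T; T < y] / E_θ [exp T; T < 0]`.

As `s ↓ 0` we have `θ → ∞`. Under the tilted measure, `T` is distributed as `∑ w_i (ξ_i² - 1)` with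
`ξ_i` independent standard normal and `w_i = θ / (a_i² + 2θ) ∈ [0, 1/2]`
(`tendsto_charFun_tiltedLaw`). Its variance `τ² = 2 ∑ w_i²` tends to infinity because each `w_i`
tends to `1/2`, while the weights stay bounded. Hence `T / τ` is asymptotically normal, and moreover
its characteristic function satisfies `|φ_T(u)| ≤ exp (-τ² min (u², 1) / 4)`. By the local limit
theorem `tendsto_setIntegral_exp_div`, the law of `T` then looks on bounded intervals like a
multiple of Lebesgue measure, so the ratio tends to `∫_{t < y} exp t / ∫_{t < 0} exp t = exp y`.

The local limit theorem is obtained by giving the law of `T` the density `exp (-|t|)`, whose Fourier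
transform is integrable. By Fubini, the characteristic function of the resulting finite measure at
`l` is `π⁻¹ ∫ φ_T(u) / (1 + (u - l)²) du`, and the two properties of `φ_T` show that this integral
is asymptotic to `√(2π) / (τ (1 + l²))`. After normalization, Lévy's theorem gives weak convergence
to the Laplace distribution, and `exp (t + |t|) 1_{t < y}` is a bounded test function whose only
discontinuity is not charged by the limit.

Membership in the class further needs the continuity and monotonicity of `ρ`, which follow from `μ`
being a continuous decreasing bijection of `[0, ∞)` onto `(0, μ(0)]`, and the right-continuity of
`s ↦ P (z < s)`, which holds because `x_0` is independent of the other variables and so the law of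
`z` has no atoms (`measure_z_eq`).
-/

namespace SmallBall

/-! ### Fourier transform of the two-sided exponential -/

section

open Complex in
lemma integral_exp_neg_abs_mul_cexp (l : ℝ) :
    ∫ t : ℝ, (Real.exp (-|t|) : ℂ) * cexp (l * t * I) = 2 / (1 + (l : ℂ) ^ 2) := by
  have h1 : (1 + l * I : ℂ) ≠ 0 := fun h => by simpa using congrArg Complex.re h
  have h2 : (-1 + l * I : ℂ) ≠ 0 := fun h => by simpa using congrArg Complex.re h
  have h3 : (1 + (l : ℂ) ^ 2) ≠ 0 := by
    norm_cast
    positivity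
  have e1 : ∀ t ∈ Iic (0 : ℝ), (Real.exp (-|t|) : ℂ) * cexp (l * t * I)
      = cexp ((1 + l * I) * t) := by
    intro t ht
    rw [abs_of_nonpos ht, ofReal_exp, ← Complex.exp_add]
    congr 1
    push_cast
    ring
  have e2 : ∀ t ∈ Ioi (0 : ℝ), (Real.exp (-|t|) : ℂ) * cexp (l * t * I)
      = cexp ((-1 + l * I) * t) := by
    intro t ht
    rw [abs_of_pos ht, ofReal_exp, ← Complex.exp_add]
    congr 1
    push_cast
    ring
  have i1 : IntegrableOn (fun t : ℝ => cexp ((1 + l * I) * t)) (Iic 0) :=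
    integrableOn_exp_mul_complex_Iic (by simp) 0
  have i2 : IntegrableOn (fun t : ℝ => cexp ((-1 + l * I) * t)) (Ioi 0) :=
    integrableOn_exp_mul_complex_Ioi (by simp) 0
  rw [← intervalIntegral.integral_Iic_add_Ioi (b := 0)
      (i1.congr_fun (fun t ht => (e1 t ht).symm) measurableSet_Iic)
      (i2.congr_fun (fun t ht => (e2 t ht).symm) measurableSet_Ioi),
    setIntegral_congr_fun measurableSet_Iic e1, setIntegral_congr_fun measurableSet_Ioi e2,
    integral_exp_mul_complex_Iic (by simp), integral_exp_mul_complex_Ioi (by simp)]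
  simp only [ofReal_zero, mul_zero, Complex.exp_zero]
  field_simp
  ring_nf
  simp only [I_sq]
  ring

lemma integrable_exp_neg_abs : Integrable fun t : ℝ => Real.exp (-|t|) := by
  rw [← integrableOn_univ, ← Iic_union_Ioi (a := (0 : ℝ))]
  refine IntegrableOn.union ?_ ?_
  · exact (integrableOn_exp_Iic 0).congr_fun
      (fun t (ht : t ≤ 0) => by simp [abs_of_nonpos ht]) measurableSet_Iic
  · exact (integrableOn_exp_neg_Ioi 0).congr_fun
      (fun t (ht : 0 < t) => by simp [abs_of_pos ht]) measurableSet_Ioi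

open Complex in
open scoped FourierTransform in
/-- The characteristic function of the Cauchy distribution, up to the factor `π`, by Fourier
inversion. -/
lemma integral_cexp_div_one_add_sq (t : ℝ) :
    ∫ u : ℝ, cexp (u * t * I) * ((1 + u ^ 2)⁻¹ : ℝ) = Real.pi * Real.exp (-|t|) := by
  have hF : 𝓕 (fun t : ℝ => (Real.exp (-|t|) : ℂ))
      = fun w : ℝ => ((2 * (1 + (w * (2 * Real.pi)) ^ 2)⁻¹ : ℝ) : ℂ) := by
    ext w
    rw [Real.fourier_real_eq_integral_exp_smul]
    have := integral_exp_neg_abs_mul_cexp (-(w * (2 * Real.pi)))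
    rw [show (((2 * (1 + (w * (2 * Real.pi)) ^ 2)⁻¹ : ℝ) : ℂ)) = 2 / (1 +
      ((-(w * (2 * Real.pi)) : ℝ) : ℂ) ^ 2) by push_cast; ring, ← this]
    congr 1 with t
    rw [smul_eq_mul, mul_comm]
    congr 2
    push_cast
    ring
  have hcont : Continuous fun t : ℝ => (Real.exp (-|t|) : ℂ) := by fun_prop
  have hint : Integrable fun t : ℝ => (Real.exp (-|t|) : ℂ) := integrable_exp_neg_abs.ofReal
  have hF' : Integrable (𝓕 fun t : ℝ => (Real.exp (-|t|) : ℂ)) := by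
    rw [hF]
    exact ((integrable_inv_one_add_sq.comp_mul_right' (by positivity)).const_mul 2).ofReal
  have key := congrFun (hcont.fourierInv_fourier_eq hint hF') t
  rw [hF, Real.fourierInv_eq'] at key
  have hsub := Measure.integral_comp_mul_right
    (fun u : ℝ => cexp (u * t * I) * ((1 + u ^ 2)⁻¹ : ℝ)) (2 * Real.pi)
  rw [← key]
  rw [abs_of_pos (by positivity)] at hsub
  have hpi : (2 * Real.pi : ℂ) ≠ 0 := by
    norm_cast; positivity
  have : (∫ u : ℝ, cexp (u * t * I) * ((1 + u ^ 2)⁻¹ : ℝ)) = (2 * Real.pi : ℝ) •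
      ∫ x : ℝ, cexp ((x * (2 * Real.pi) : ℝ) * t * I) * ((1 + (x * (2 * Real.pi)) ^ 2)⁻¹ : ℝ) := by
    rw [hsub, smul_smul, mul_inv_cancel₀ (by positivity), one_smul]
  rw [this, ← integral_smul, ← integral_const_mul]
  congr 1 with x
  simp only [real_smul, smul_eq_mul, RCLike.inner_apply, conj_trivial]
  push_cast
  rw [show (2 * Real.pi * (t * x) * I : ℂ) = x * (2 * Real.pi) * t * I by ring]
  ring

open Complex in
/-- The characteristic function of the finite measure `exp (-|t|) Q(dt)`, in terms of that of
`Q`: the weight `exp (-|t|)` has the integrable Fourier transform `2 / (1 + u²)`. -/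
lemma integral_exp_neg_abs_mul_cexp_eq (Q : Measure ℝ) [IsProbabilityMeasure Q] (l : ℝ) :
    ∫ t : ℝ, (Real.exp (-|t|) : ℂ) * cexp (l * t * I) ∂Q
      = (Real.pi : ℂ)⁻¹ * ∫ u : ℝ, charFun Q u * ((1 + (u - l) ^ 2)⁻¹ : ℝ) := by
  have hpi : (Real.pi : ℂ) ≠ 0 := by exact_mod_cast Real.pi_ne_zero
  have h1 : ∀ t : ℝ, (Real.exp (-|t|) : ℂ) * cexp (l * t * I)
      = (Real.pi : ℂ)⁻¹ * ∫ u : ℝ, cexp (u * t * I) * ((1 + (u - l) ^ 2)⁻¹ : ℝ) := by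
    intro t
    rw [← integral_add_right_eq_self (fun u : ℝ => cexp (u * t * I) * ((1 + (u - l) ^ 2)⁻¹ : ℝ)) l]
    have : ∀ u : ℝ, cexp (((u + l : ℝ) : ℂ) * t * I) * ((1 + (u + l - l) ^ 2)⁻¹ : ℝ)
        = cexp (l * t * I) * (cexp (u * t * I) * ((1 + u ^ 2)⁻¹ : ℝ)) := by
      intro u
      rw [← mul_assoc, ← Complex.exp_add, add_sub_cancel_right]
      congr 2
      push_cast
      ring
    simp_rw [this]
    rw [integral_const_mul, integral_cexp_div_one_add_sq]
    field_simp
  simp_rw [h1]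
  rw [integral_const_mul]
  congr 1
  rw [integral_integral_swap]
  · congr 1 with u
    rw [integral_mul_const, charFun_apply_real]
  · have hi : Integrable fun u : ℝ => (1 + (u - l) ^ 2)⁻¹ :=
      integrable_inv_one_add_sq.comp_sub_right l
    refine Integrable.mono' (g := fun p : ℝ × ℝ => (1 + (p.2 - l) ^ 2)⁻¹) (hi.comp_snd Q) ?_ ?_
    · refine Measurable.aestronglyMeasurable ?_
      unfold Function.uncurry
      fun_prop
    · refine ae_of_all _ fun p => ?_
      simp only [Function.uncurry]
      rw [norm_mul, ← ofReal_mul, norm_exp_ofReal_mul_I, one_mul, norm_real, Real.norm_eq_abs,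
        abs_of_nonneg (by positivity)]

end

/-! ### Concentration of the Fourier integral at low frequencies -/

section

lemma tendsto_mul_exp_neg_mul_sq {τ : ℕ → ℝ} (hτ : Tendsto τ atTop atTop) {c : ℝ} (hc : 0 < c) :
    Tendsto (fun n => τ n * Real.exp (-(c * τ n ^ 2))) atTop (𝓝 0) := by
  have h := (Real.tendsto_pow_mul_exp_neg_atTop_nhds_zero 1).comp (hτ.const_mul_atTop hc)
  have h' := h.const_mul (c⁻¹)
  rw [mul_zero] at h'
  refine squeeze_zero' ?_ ?_ h'
  · filter_upwards [hτ.eventually_ge_atTop 0] with n hn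
    positivity
  · filter_upwards [hτ.eventually_ge_atTop 1] with n hn
    have : c⁻¹ * (((fun x => x ^ 1 * Real.exp (-x)) ∘ fun x => c * τ x) n)
        = τ n * Real.exp (-(c * τ n)) := by
      simp only [Function.comp, pow_one]
      field_simp
    rw [this]
    gcongr
    nlinarith

open Complex in
/-- After the substitution `u = v / τ n`, the Gaussian limit of the characteristic functions at
frequencies of order `1 / τ n` determines the integral: the kernel is frozen at its value
`1 / (1 + l²)` at the origin. -/
lemma tendsto_mul_integral_charFun {Q : ℕ → Measure ℝ} [∀ n, IsProbabilityMeasure (Q n)]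
    {τ : ℕ → ℝ} (hτ : Tendsto τ atTop atTop) {c : ℝ} (hc : 0 < c)
    (hdecay : ∀ n u, ‖charFun (Q n) u‖ ≤ Real.exp (-(c * τ n ^ 2 * min (u ^ 2) 1)))
    (hlim : ∀ v : ℝ, Tendsto (fun n => charFun (Q n) (v / τ n)) atTop
      (𝓝 (Real.exp (-(v ^ 2) / 2)))) (l : ℝ) :
    Tendsto (fun n => (τ n : ℂ) * ∫ u : ℝ, charFun (Q n) u * ((1 + (u - l) ^ 2)⁻¹ : ℝ)) atTop
      (𝓝 (√(2 * Real.pi) * (1 + l ^ 2)⁻¹ : ℝ)) := by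
  have hi : Integrable fun u : ℝ => (1 + (u - l) ^ 2)⁻¹ :=
    integrable_inv_one_add_sq.comp_sub_right l
  have hmeas : ∀ n, AEStronglyMeasurable
      (fun u : ℝ => charFun (Q n) u * ((1 + (u - l) ^ 2)⁻¹ : ℝ)) volume := fun n =>
    (Measurable.mul measurable_charFun (by fun_prop)).aestronglyMeasurable
  have hint : ∀ n, Integrable (fun u : ℝ => charFun (Q n) u * ((1 + (u - l) ^ 2)⁻¹ : ℝ)) := by
    intro n
    refine hi.mono' (hmeas n) (ae_of_all _ fun u => ?_)
    rw [norm_mul, norm_real, Real.norm_eq_abs, abs_of_nonneg (by positivity)]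
    exact mul_le_of_le_one_left (by positivity) (norm_charFun_le_one u)
  -- the low frequencies carry the limit
  have hA : Tendsto (fun n => (τ n : ℂ) * ∫ u in Icc (-1 : ℝ) 1,
      charFun (Q n) u * ((1 + (u - l) ^ 2)⁻¹ : ℝ)) atTop
      (𝓝 (√(2 * Real.pi) * (1 + l ^ 2)⁻¹ : ℝ)) := by
    have hev : (fun n => ∫ v : ℝ, (Icc (-τ n) (τ n)).indicator (fun v => charFun (Q n) (v / τ n) *
        ((1 + (v / τ n - l) ^ 2)⁻¹ : ℝ)) v) =ᶠ[atTop] fun n => (τ n : ℂ) * ∫ u in Icc (-1 : ℝ) 1,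
        charFun (Q n) u * ((1 + (u - l) ^ 2)⁻¹ : ℝ) := by
      filter_upwards [hτ.eventually_gt_atTop 0] with n hn
      have := Measure.integral_comp_div (fun u => (Icc (-1 : ℝ) 1).indicator (fun u =>
        charFun (Q n) u * ((1 + (u - l) ^ 2)⁻¹ : ℝ)) u) (τ n)
      rw [abs_of_pos hn, integral_indicator measurableSet_Icc, real_smul] at this
      rw [← this]
      congr 1 with v
      have hiff : v ∈ Icc (-τ n) (τ n) ↔ v / τ n ∈ Icc (-1 : ℝ) 1 := by
        rw [mem_Icc, mem_Icc, le_div_iff₀ hn, div_le_iff₀ hn]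
        simp
      by_cases hv : v ∈ Icc (-τ n) (τ n)
      · rw [indicator_of_mem hv, indicator_of_mem (hiff.1 hv)]
      · rw [indicator_of_notMem hv, indicator_of_notMem (fun h => hv (hiff.2 h))]
    refine Tendsto.congr' hev ?_
    have hval : ((√(2 * Real.pi) * (1 + l ^ 2)⁻¹ : ℝ) : ℂ)
        = ∫ v : ℝ, ((Real.exp (-(v ^ 2) / 2) * (1 + l ^ 2)⁻¹ : ℝ) : ℂ) := by
      rw [integral_complex_ofReal, integral_mul_const]
      congr 3
      have := integral_gaussian (1 / 2)
      rw [show Real.pi / (1 / 2) = 2 * Real.pi by ring] at this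
      rw [← this]
      congr 1 with v
      ring_nf
    rw [hval]
    refine tendsto_integral_filter_of_dominated_convergence (fun v => Real.exp (-c * v ^ 2))
      ?_ ?_ (integrable_exp_neg_mul_sq hc) ?_
    · refine Eventually.of_forall fun n => ?_
      refine (Measurable.indicator (Measurable.mul ?_ (by fun_prop))
        measurableSet_Icc).aestronglyMeasurable
      exact measurable_charFun.comp (measurable_id.div_const _)
    · filter_upwards [hτ.eventually_gt_atTop 0] with n hn
      refine ae_of_all _ fun v => ?_
      by_cases hv : v ∈ Icc (-τ n) (τ n)
      · rw [indicator_of_mem hv, norm_mul, norm_real, Real.norm_eq_abs,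
          abs_of_nonneg (by positivity)]
        have hle : (1 + (v / τ n - l) ^ 2)⁻¹ ≤ 1 :=
          inv_le_one_of_one_le₀ (by nlinarith [sq_nonneg (v / τ n - l)])
        refine (mul_le_of_le_one_right (norm_nonneg _) hle).trans ((hdecay n _).trans ?_)
        have h1 : (v / τ n) ^ 2 ≤ 1 := by
          rw [div_pow, div_le_one (by positivity)]
          exact sq_le_sq' hv.1 hv.2
        rw [min_eq_left h1]
        apply le_of_eq
        congr 1
        field_simp
      · rw [indicator_of_notMem hv, norm_zero]
        positivity
    · refine ae_of_all _ fun v => ?_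
      have hev2 : (fun n => charFun (Q n) (v / τ n) * ((1 + (v / τ n - l) ^ 2)⁻¹ : ℝ))
          =ᶠ[atTop] fun n => (Icc (-τ n) (τ n)).indicator (fun v => charFun (Q n) (v / τ n) *
        ((1 + (v / τ n - l) ^ 2)⁻¹ : ℝ)) v := by
        filter_upwards [hτ.eventually_ge_atTop |v|] with n hn
        rw [indicator_of_mem (mem_Icc.2 (abs_le.1 hn))]
      refine Tendsto.congr' hev2 ?_
      rw [ofReal_mul]
      refine (hlim v).mul ((continuous_ofReal.tendsto _).comp ?_)
      have h0 : Tendsto (fun n => v / τ n) atTop (𝓝 0) := hτ.const_div_atTop v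
      have : Continuous fun y : ℝ => (1 + (y - l) ^ 2)⁻¹ :=
        Continuous.inv₀ (by fun_prop) (fun y => by positivity)
      simpa [Function.comp_def] using (this.tendsto 0).comp h0
  -- the high frequencies contribute at most `τ exp (-c τ²)` times the integral of the kernel
  have hB : Tendsto (fun n => (τ n : ℂ) * ∫ u in (Icc (-1 : ℝ) 1)ᶜ,
      charFun (Q n) u * ((1 + (u - l) ^ 2)⁻¹ : ℝ)) atTop (𝓝 0) := by
    have h0 := (tendsto_mul_exp_neg_mul_sq hτ hc).mul_const (∫ u : ℝ, (1 + (u - l) ^ 2)⁻¹)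
    rw [zero_mul] at h0
    refine squeeze_zero_norm' ?_ h0
    filter_upwards [hτ.eventually_gt_atTop 0] with n hn
    rw [norm_mul, norm_real, Real.norm_eq_abs, abs_of_pos hn, mul_assoc]
    gcongr
    calc _ ≤ ∫ u in (Icc (-1 : ℝ) 1)ᶜ, Real.exp (-(c * τ n ^ 2)) * (1 + (u - l) ^ 2)⁻¹ := by
          refine norm_integral_le_of_norm_le (hi.const_mul _).integrableOn ?_
          refine (ae_restrict_iff' measurableSet_Icc.compl).2 (ae_of_all _ fun u hu => ?_)
          rw [norm_mul, norm_real, Real.norm_eq_abs, abs_of_nonneg (by positivity)]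
          gcongr
          refine (hdecay n u).trans ?_
          have : 1 ≤ u ^ 2 := by
            by_contra! h
            exact hu (mem_Icc.2 (abs_le.1 ((sq_lt_one_iff_abs_lt_one u).1 h).le))
          rw [min_eq_right this, mul_one]
      _ ≤ ∫ u : ℝ, Real.exp (-(c * τ n ^ 2)) * (1 + (u - l) ^ 2)⁻¹ :=
          setIntegral_le_integral (hi.const_mul _) (ae_of_all _ fun u => by positivity)
      _ = _ := integral_const_mul _ _
  have hAB := hA.add hB
  rw [add_zero] at hAB
  refine hAB.congr fun n => ?_
  rw [← mul_add, integral_add_compl measurableSet_Icc (hint n)]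

/-- The Laplace distribution, with density `exp (-|t|) / 2`. -/
noncomputable def laplaceMeasure : Measure ℝ :=
  volume.withDensity fun t => ENNReal.ofReal (Real.exp (-|t|) / 2)

lemma integral_laplaceMeasure {E : Type*} [NormedAddCommGroup E] [NormedSpace ℝ E] (g : ℝ → E) :
    ∫ t, g t ∂laplaceMeasure = ∫ t, (Real.exp (-|t|) / 2) • g t := by
  rw [laplaceMeasure, integral_withDensity_eq_integral_toReal_smul (by fun_prop) (by simp)]
  congr 1 with t
  rw [ENNReal.toReal_ofReal (by positivity)]

open Complex in
lemma integral_cexp_laplaceMeasure (l : ℝ) :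
    ∫ t : ℝ, cexp (l * t * I) ∂laplaceMeasure = ((1 + l ^ 2)⁻¹ : ℝ) := by
  rw [integral_laplaceMeasure]
  have := integral_exp_neg_abs_mul_cexp l
  calc _ = 2⁻¹ * ∫ t : ℝ, (Real.exp (-|t|) : ℂ) * cexp (l * t * I) := by
        rw [← integral_const_mul]
        congr 1 with t
        rw [real_smul]
        push_cast
        ring
    _ = _ := by
        rw [this]
        push_cast
        ring

instance : IsProbabilityMeasure laplaceMeasure := by
  constructor
  rw [laplaceMeasure, withDensity_apply _ MeasurableSet.univ, setLIntegral_univ,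
    ← ofReal_integral_eq_lintegral_ofReal (integrable_exp_neg_abs.div_const 2)
      (ae_of_all _ fun t => by positivity)]
  have := integral_exp_neg_abs_mul_cexp 0
  simp only [Complex.ofReal_zero, zero_mul, Complex.exp_zero, mul_one,
    integral_complex_ofReal] at this
  norm_num at this
  rw [integral_div, show (∫ t : ℝ, Real.exp (-|t|)) = 2 from mod_cast this]
  norm_num

lemma charFun_laplaceMeasure (l : ℝ) :
    charFun laplaceMeasure l = ((1 + l ^ 2)⁻¹ : ℝ) := by
  rw [charFun_apply_real, integral_cexp_laplaceMeasure]

end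

/-! ### A local limit theorem from characteristic functions -/

section

lemma integrable_exp_neg_abs_of_isFiniteMeasure (Q : Measure ℝ) [IsFiniteMeasure Q] :
    Integrable (fun t : ℝ => Real.exp (-|t|)) Q :=
  Integrable.of_bound (by fun_prop) 1 (ae_of_all _ fun t => by
    rw [Real.norm_eq_abs, Real.abs_exp, Real.exp_le_one_iff]
    exact neg_nonpos.2 (abs_nonneg t))

open Complex in
lemma charFun_tilted_neg_abs (Q : Measure ℝ) [IsProbabilityMeasure Q] (l : ℝ) :
    charFun (Q.tilted fun t => -|t|) l =
      (∫ u : ℝ, charFun Q u * ((1 + (u - l) ^ 2)⁻¹ : ℝ)) /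
        ∫ u : ℝ, charFun Q u * ((1 + (u - 0) ^ 2)⁻¹ : ℝ) := by
  have hpi : (Real.pi : ℂ) ≠ 0 := by exact_mod_cast Real.pi_ne_zero
  have h := integral_exp_neg_abs_mul_cexp_eq Q
  have h0 : ((∫ t : ℝ, Real.exp (-|t|) ∂Q : ℝ) : ℂ) =
      (Real.pi : ℂ)⁻¹ * ∫ u : ℝ, charFun Q u * ((1 + (u - 0) ^ 2)⁻¹ : ℝ) := by
    rw [← h 0, ← integral_complex_ofReal]
    simp
  have hl := h l
  rw [charFun_apply_real, integral_tilted]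
  calc _ = ((∫ t : ℝ, Real.exp (-|t|) ∂Q : ℝ) : ℂ)⁻¹ *
        ∫ t : ℝ, (Real.exp (-|t|) : ℂ) * cexp (l * t * I) ∂Q := by
        rw [← integral_const_mul]
        congr 1 with t
        rw [real_smul]
        push_cast
        ring
    _ = _ := by
        rw [h0, hl]
        field_simp

/-- Under the hypotheses of a local limit theorem on `Q n`, the probability measures
proportional to `exp (-|t|) Q n (dt)` converge weakly to the Laplace distribution; that is,
`Q n` looks like a multiple of Lebesgue measure on bounded intervals. -/
lemma tendsto_tilted_neg_abs {Q : ℕ → Measure ℝ} [∀ n, IsProbabilityMeasure (Q n)]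
    {τ : ℕ → ℝ} (hτ : Tendsto τ atTop atTop) {c : ℝ} (hc : 0 < c)
    (hdecay : ∀ n u, ‖charFun (Q n) u‖ ≤ Real.exp (-(c * τ n ^ 2 * min (u ^ 2) 1)))
    (hlim : ∀ v : ℝ, Tendsto (fun n => charFun (Q n) (v / τ n)) atTop
      (𝓝 (Real.exp (-(v ^ 2) / 2)))) :
    Tendsto (β := ProbabilityMeasure ℝ) (fun n => ⟨(Q n).tilted fun t => -|t|,
      isProbabilityMeasure_tilted (integrable_exp_neg_abs_of_isFiniteMeasure (Q n))⟩) atTop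
      (𝓝 ⟨laplaceMeasure, inferInstance⟩) := by
  refine ProbabilityMeasure.tendsto_iff_tendsto_charFun.2 fun l => ?_
  simp only [ProbabilityMeasure.coe_mk]
  have hl := tendsto_mul_integral_charFun hτ hc hdecay hlim l
  have h0 := tendsto_mul_integral_charFun hτ hc hdecay hlim 0
  have hne : ((√(2 * Real.pi) * (1 + (0 : ℝ) ^ 2)⁻¹ : ℝ) : ℂ) ≠ 0 := by
    norm_cast
    positivity
  have h := hl.div h0 hne
  have hlimit : ((√(2 * Real.pi) * (1 + l ^ 2)⁻¹ : ℝ) : ℂ) /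
      ((√(2 * Real.pi) * (1 + (0 : ℝ) ^ 2)⁻¹ : ℝ) : ℂ) = charFun laplaceMeasure l := by
    have hs : ((√(2 * Real.pi) : ℝ) : ℂ) ≠ 0 := by
      norm_cast
      positivity
    rw [charFun_laplaceMeasure]
    push_cast
    field_simp
    simp
  rw [hlimit] at h
  refine h.congr' ?_
  filter_upwards [hτ.eventually_gt_atTop 0] with n hn
  have hn' : (τ n : ℂ) ≠ 0 := by exact_mod_cast hn.ne'
  rw [charFun_tilted_neg_abs, Pi.div_apply, mul_div_mul_left _ _ hn']

lemma setIntegral_exp_eq_tilted (Q : Measure ℝ) [IsProbabilityMeasure Q] (x : ℝ) :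
    ∫ t in Iio x, Real.exp t ∂Q = (∫ t, Real.exp (-|t|) ∂Q) *
      ∫ t, (Iio x).indicator (fun t => Real.exp (t + |t|)) t ∂(Q.tilted fun t => -|t|) := by
  have hpos : 0 < ∫ t, Real.exp (-|t|) ∂Q :=
    integral_exp_pos (integrable_exp_neg_abs_of_isFiniteMeasure Q)
  rw [integral_tilted, ← integral_const_mul, ← integral_indicator measurableSet_Iio]
  congr 1 with t
  by_cases ht : t ∈ Iio x
  · have h : Real.exp t = Real.exp (-|t|) * Real.exp (t + |t|) := by
      rw [← Real.exp_add]
      congr 1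
      ring
    rw [indicator_of_mem ht, indicator_of_mem ht, smul_eq_mul, h]
    field_simp
  · rw [indicator_of_notMem ht, indicator_of_notMem ht]
    simp

lemma integral_indicator_laplaceMeasure (x : ℝ) :
    ∫ t, (Iio x).indicator (fun t => Real.exp (t + |t|)) t ∂laplaceMeasure
      = Real.exp x / 2 := by
  rw [integral_laplaceMeasure, ← integral_exp_Iic, integral_Iic_eq_integral_Iio,
    ← integral_div, ← integral_indicator measurableSet_Iio]
  congr 1 with t
  by_cases ht : t ∈ Iio x
  · rw [indicator_of_mem ht, indicator_of_mem ht, smul_eq_mul, div_mul_eq_mul_div,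
      ← Real.exp_add]
    congr 2
    ring
  · rw [indicator_of_notMem ht, indicator_of_notMem ht, smul_zero]

lemma tendsto_integral_indicator_exp {ν : ℕ → ProbabilityMeasure ℝ} {ν₀ : ProbabilityMeasure ℝ}
    (hν : Tendsto ν atTop (𝓝 ν₀)) (x : ℝ) (hx : (ν₀ : Measure ℝ) {x} = 0) :
    Tendsto (fun n => ∫ t, (Iio x).indicator (fun t => Real.exp (t + |t|)) t ∂(ν n : Measure ℝ))
      atTop (𝓝 (∫ t, (Iio x).indicator (fun t => Real.exp (t + |t|)) t ∂(ν₀ : Measure ℝ))) := by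
  have hle : ∀ s t : ℝ, s ≤ t → s + |s| ≤ t + |t| := by
    intro s t hst
    rcases abs_cases s with ⟨h, _⟩ | ⟨h, _⟩ <;> rcases abs_cases t with ⟨h', _⟩ | ⟨h', _⟩ <;>
      linarith
  -- the integrand is a bounded continuous function minus a multiple of the indicator of `[x, ∞)`
  let m : BoundedContinuousFunction ℝ ℝ := BoundedContinuousFunction.ofNormedAddCommGroup
    (fun t => Real.exp (min t x + |min t x|)) (by fun_prop) (Real.exp (x + |x|)) (fun t => by
      rw [Real.norm_eq_abs, Real.abs_exp, Real.exp_le_exp]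
      exact hle _ _ (min_le_right _ _))
  have heq : ∀ t, (Iio x).indicator (fun t => Real.exp (t + |t|)) t
      = m t - (Ici x).indicator (fun _ => Real.exp (x + |x|)) t := by
    intro t
    change _ = Real.exp (min t x + |min t x|) - _
    by_cases ht : t < x
    · rw [indicator_of_mem (mem_Iio.2 ht), indicator_of_notMem (by simpa using ht),
        min_eq_left ht.le, sub_zero]
    · rw [indicator_of_notMem (by simpa using ht), indicator_of_mem (by simpa using ht),
        min_eq_right (not_lt.1 ht), sub_self]
  have hint : ∀ μ : ProbabilityMeasure ℝ,
      ∫ t, (Iio x).indicator (fun t => Real.exp (t + |t|)) t ∂(μ : Measure ℝ)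
        = (∫ t, m t ∂(μ : Measure ℝ)) - (μ : Measure ℝ).real (Ici x) * Real.exp (x + |x|) := by
    intro μ
    simp_rw [heq]
    rw [integral_sub (m.integrable _) ((integrable_const _).indicator measurableSet_Ici),
      integral_indicator_const _ measurableSet_Ici, smul_eq_mul]
  simp_rw [hint]
  refine ((ProbabilityMeasure.tendsto_iff_forall_integral_tendsto.1 hν) m).sub
    (Tendsto.mul_const _ ?_)
  exact (ENNReal.tendsto_toReal (measure_ne_top _ _)).comp
    (ProbabilityMeasure.tendsto_measure_of_null_frontier_of_tendsto' hν (by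
      rwa [frontier_Ici]))

/-- **A local limit theorem.** Suppose that, after rescaling by `τ n → ∞`, the characteristic
functions of `Q n` converge to that of the standard normal distribution and satisfy a uniform
Gaussian-type bound. Then `Q n` behaves near the origin like a multiple of Lebesgue measure, so that
ratios of integrals of `exp` over half-lines converge to those for Lebesgue measure. -/
theorem tendsto_setIntegral_exp_div {Q : ℕ → Measure ℝ} [∀ n, IsProbabilityMeasure (Q n)]
    {τ : ℕ → ℝ} (hτ : Tendsto τ atTop atTop) {c : ℝ} (hc : 0 < c)
    (hdecay : ∀ n u, ‖charFun (Q n) u‖ ≤ Real.exp (-(c * τ n ^ 2 * min (u ^ 2) 1)))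
    (hlim : ∀ v : ℝ, Tendsto (fun n => charFun (Q n) (v / τ n)) atTop
      (𝓝 (Real.exp (-(v ^ 2) / 2)))) (x : ℝ) :
    Tendsto (fun n => (∫ t in Iio x, Real.exp t ∂Q n) / ∫ t in Iio 0, Real.exp t ∂Q n) atTop
      (𝓝 (Real.exp x)) := by
  have hν := tendsto_tilted_neg_abs hτ hc hdecay hlim
  have hnull : ∀ y : ℝ, laplaceMeasure {y} = 0 := fun y =>
    withDensity_absolutelyContinuous _ _ (measure_singleton y)
  have h1 := tendsto_integral_indicator_exp hν x (hnull x)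
  have h0 := tendsto_integral_indicator_exp hν 0 (hnull 0)
  simp only [ProbabilityMeasure.coe_mk, integral_indicator_laplaceMeasure] at h1 h0
  have h := h1.div h0 (by positivity)
  rw [Real.exp_zero, div_div_div_cancel_right₀ two_ne_zero, div_one] at h
  refine h.congr fun n => ?_
  rw [setIntegral_exp_eq_tilted, setIntegral_exp_eq_tilted, Pi.div_apply, mul_div_mul_left]
  exact (integral_exp_pos (integrable_exp_neg_abs_of_isFiniteMeasure (Q n))).ne'

end

/-! ### The function `μ` and its generalized inverse -/

section

variable {a : ℕ → ℝ}

lemma add_two_mul_pos (ha0 : ∀ i, a i ≠ 0) {θ : ℝ} (hθ : 0 ≤ θ) (i : ℕ) :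
    0 < a i ^ 2 + 2 * θ := by
  have := ha0 i
  positivity

lemma one_div_le_one_div_sq (ha0 : ∀ i, a i ≠ 0) {θ : ℝ} (hθ : 0 ≤ θ) (i : ℕ) :
    1 / (a i ^ 2 + 2 * θ) ≤ 1 / a i ^ 2 := by
  have := ha0 i
  exact one_div_le_one_div_of_le (by positivity) (by linarith)

lemma summable_mu (ha0 : ∀ i, a i ≠ 0) (hsum : Summable fun i => 1 / a i ^ 2) {θ : ℝ}
    (hθ : 0 ≤ θ) : Summable fun i => 1 / (a i ^ 2 + 2 * θ) :=
  hsum.of_nonneg_of_le (fun i => (one_div_pos.2 (add_two_mul_pos ha0 hθ i)).le)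
    (one_div_le_one_div_sq ha0 hθ)

lemma mu_pos (ha0 : ∀ i, a i ≠ 0) (hsum : Summable fun i => 1 / a i ^ 2) {θ : ℝ}
    (hθ : 0 ≤ θ) : 0 < mu a θ :=
  (summable_mu ha0 hsum hθ).tsum_pos (fun i => (one_div_pos.2 (add_two_mul_pos ha0 hθ i)).le) 0
    (one_div_pos.2 (add_two_mul_pos ha0 hθ 0))

lemma strictAntiOn_mu (ha0 : ∀ i, a i ≠ 0) (hsum : Summable fun i => 1 / a i ^ 2) :
    StrictAntiOn (mu a) (Ici 0) := by
  intro θ hθ η hη h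
  have hlt : ∀ i, 1 / (a i ^ 2 + 2 * η) < 1 / (a i ^ 2 + 2 * θ) := fun i =>
    one_div_lt_one_div_of_lt (add_two_mul_pos ha0 hθ i) (by linarith)
  exact Summable.tsum_lt_tsum (fun i => (hlt i).le) (hlt 0) (summable_mu ha0 hsum hη)
    (summable_mu ha0 hsum hθ)

lemma continuousOn_mu (ha0 : ∀ i, a i ≠ 0) (hsum : Summable fun i => 1 / a i ^ 2) :
    ContinuousOn (mu a) (Ici 0) := by
  refine continuousOn_tsum (fun i => ?_) hsum fun i θ hθ => ?_
  · exact ContinuousOn.div (by fun_prop) (by fun_prop) fun θ hθ => (add_two_mul_pos ha0 hθ i).ne'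
  · rw [Real.norm_of_nonneg (one_div_pos.2 (add_two_mul_pos ha0 hθ i)).le]
    exact one_div_le_one_div_sq ha0 hθ i

lemma tendsto_mu_atTop (ha0 : ∀ i, a i ≠ 0) (hsum : Summable fun i => 1 / a i ^ 2) :
    Tendsto (mu a) atTop (𝓝 0) := by
  rw [← tsum_zero (α := ℝ) (β := ℕ)]
  refine tendsto_tsum_of_dominated_convergence hsum (fun i => ?_) ?_
  · refine Tendsto.div_atTop tendsto_const_nhds ?_
    exact tendsto_atTop_add_const_left _ _ (tendsto_id.const_mul_atTop two_pos)
  · filter_upwards [eventually_ge_atTop 0] with θ hθ i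
    rw [Real.norm_of_nonneg (one_div_pos.2 (add_two_mul_pos ha0 hθ i)).le]
    exact one_div_le_one_div_sq ha0 hθ i

lemma exists_mu_eq (ha0 : ∀ i, a i ≠ 0) (hsum : Summable fun i => 1 / a i ^ 2) {s : ℝ}
    (hs : 0 < s) (hs' : s < mu a 0) : ∃ θ, 0 < θ ∧ mu a θ = s := by
  obtain ⟨η, hη, hηs⟩ := ((eventually_ge_atTop (0 : ℝ)).and
    ((tendsto_mu_atTop ha0 hsum).eventually_lt_const hs)).exists
  obtain ⟨θ, hθ, rfl⟩ := intermediate_value_Icc' hη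
    ((continuousOn_mu ha0 hsum).mono Icc_subset_Ici_self) ⟨hηs.le, hs'.le⟩
  refine ⟨θ, lt_of_le_of_ne hθ.1 ?_, rfl⟩
  rintro rfl
  exact lt_irrefl _ hs'

/-- Since `mu a` is strictly decreasing on `[0, ∞)`, its generalized inverse inverts it. At `θ = 0`
both sides are `0`, by the conventions `∞.toReal = 0` and `0⁻¹ = 0`. -/
lemma rho_mu (ha0 : ∀ i, a i ≠ 0) (hsum : Summable fun i => 1 / a i ^ 2) {θ : ℝ}
    (hθ : 0 ≤ θ) : rho a (mu a θ) = θ⁻¹ := by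
  have h : genInv (mu a) (mu a θ) = ENNReal.ofReal θ := by
    refine le_antisymm ((iInf₂_le
      (f := fun (η : ℝ≥0) (_ : mu a η ≤ mu a θ) => (η : ℝ≥0∞)) ⟨θ, hθ⟩ le_rfl).trans_eq ?_)
      (le_iInf₂ fun η hη => ?_)
    · rw [ENNReal.ofReal_eq_coe_nnreal hθ]
      rfl
    · rw [← ENNReal.ofReal_coe_nnreal]
      exact ENNReal.ofReal_le_ofReal
        (((strictAntiOn_mu ha0 hsum).le_iff_ge (mem_Ici.2 η.2) (mem_Ici.2 hθ)).1 hη)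
  rw [rho, h, ENNReal.toReal_inv, ENNReal.toReal_ofReal hθ]

lemma rho_zero (ha0 : ∀ i, a i ≠ 0) (hsum : Summable fun i => 1 / a i ^ 2) : rho a 0 = 0 := by
  have h : genInv (mu a) 0 = ⊤ := by
    simp only [genInv, iInf_eq_top]
    exact fun η hη => absurd hη (mu_pos ha0 hsum η.2).not_ge
  rw [rho, h, ENNReal.inv_top, ENNReal.toReal_zero]

lemma monotoneOn_rho (ha0 : ∀ i, a i ≠ 0) (hsum : Summable fun i => 1 / a i ^ 2) :
    MonotoneOn (rho a) (Ico 0 (mu a 0)) := by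
  intro s hs t ht hst
  rcases hs.1.eq_or_lt with rfl | hs0
  · rw [rho_zero ha0 hsum]
    exact ENNReal.toReal_nonneg
  · obtain ⟨θ, hθ, rfl⟩ := exists_mu_eq ha0 hsum hs0 hs.2
    obtain ⟨η, hη, rfl⟩ := exists_mu_eq ha0 hsum (hs0.trans_le hst) ht.2
    rw [rho_mu ha0 hsum hθ.le, rho_mu ha0 hsum hη.le]
    exact inv_anti₀ hη (((strictAntiOn_mu ha0 hsum).le_iff_ge (mem_Ici.2 hθ.le)
      (mem_Ici.2 hη.le)).1 hst)

lemma Ici_subset_image_rho (ha0 : ∀ i, a i ≠ 0) (hsum : Summable fun i => 1 / a i ^ 2) :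
    Ici 0 ⊆ rho a '' Ico 0 (mu a 0) := by
  intro r hr
  rcases (mem_Ici.1 hr).eq_or_lt with rfl | hr0
  · exact ⟨0, ⟨le_rfl, mu_pos ha0 hsum le_rfl⟩, rho_zero ha0 hsum⟩
  · have hr' : 0 < r⁻¹ := inv_pos.2 hr0
    refine ⟨mu a r⁻¹, ⟨(mu_pos ha0 hsum hr'.le).le, ?_⟩, ?_⟩
    · exact strictAntiOn_mu ha0 hsum (mem_Ici.2 le_rfl) (mem_Ici.2 hr'.le) hr'
    · rw [rho_mu ha0 hsum hr'.le, inv_inv]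

lemma continuousOn_rho (ha0 : ∀ i, a i ≠ 0) (hsum : Summable fun i => 1 / a i ^ 2) :
    ContinuousOn (rho a) (Ico 0 (mu a 0)) := by
  intro s hs
  rcases hs.1.eq_or_lt with rfl | hs0
  · refine ContinuousWithinAt.mono (t := Ici 0) ?_ Ico_subset_Ici_self
    refine continuousWithinAt_right_of_monotoneOn_of_image_mem_nhdsWithin
      (monotoneOn_rho ha0 hsum) (Ico_mem_nhdsGE hs.2) ?_
    rw [rho_zero ha0 hsum]
    exact mem_of_superset self_mem_nhdsWithin (Ici_subset_image_rho ha0 hsum)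
  · refine ContinuousAt.continuousWithinAt ?_
    refine continuousAt_of_monotoneOn_of_image_mem_nhds (monotoneOn_rho ha0 hsum)
      (Ico_mem_nhds hs0 hs.2) (mem_of_superset ?_ (Ici_subset_image_rho ha0 hsum))
    obtain ⟨θ, hθ, rfl⟩ := exists_mu_eq ha0 hsum hs0 hs.2
    rw [rho_mu ha0 hsum hθ.le]
    exact Ici_mem_nhds (inv_pos.2 hθ)

lemma tendsto_inv_rho (ha0 : ∀ i, a i ≠ 0) (hsum : Summable fun i => 1 / a i ^ 2) :
    Tendsto (fun s => (rho a s)⁻¹) (𝓝[>] 0) atTop := by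
  refine tendsto_inv_nhdsGT_zero.comp (tendsto_nhdsWithin_iff.2 ⟨?_, ?_⟩)
  · have h := (continuousOn_rho ha0 hsum) 0 ⟨le_rfl, mu_pos ha0 hsum le_rfl⟩
    rw [ContinuousWithinAt, rho_zero ha0 hsum] at h
    exact h.mono_left (nhdsWithin_le_of_mem
      (mem_of_superset (Ioo_mem_nhdsGT (mu_pos ha0 hsum le_rfl)) Ioo_subset_Ico_self))
  · filter_upwards [Ioo_mem_nhdsGT (mu_pos ha0 hsum le_rfl)] with s hs
    obtain ⟨θ, hθ, rfl⟩ := exists_mu_eq ha0 hsum hs.1 hs.2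
    rw [rho_mu ha0 hsum hθ.le]
    exact inv_pos.2 hθ

lemma mu_inv_rho (ha0 : ∀ i, a i ≠ 0) (hsum : Summable fun i => 1 / a i ^ 2) :
    ∀ᶠ s in 𝓝[>] 0, mu a (rho a s)⁻¹ = s := by
  filter_upwards [Ioo_mem_nhdsGT (mu_pos ha0 hsum le_rfl)] with s hs
  obtain ⟨θ, hθ, rfl⟩ := exists_mu_eq ha0 hsum hs.1 hs.2
  rw [rho_mu ha0 hsum hθ.le, inv_inv]

end

/-! ### Characteristic functions of weighted sums of centred squares -/

section

/-- The logarithm of the characteristic function at `u` of `w (ξ² - 1)`, for `ξ` standard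
normal. -/
noncomputable def logFactor (w u : ℝ) : ℂ :=
  -(1 / 2) * Complex.log (1 - 2 * u * w * Complex.I) - u * w * Complex.I

lemma re_logFactor (w u : ℝ) :
    (logFactor w u).re = -(1 / 4) * Real.log (1 + 4 * u ^ 2 * w ^ 2) := by
  have h1 : (1 - 2 * u * w * Complex.I : ℂ) =
      ((1 : ℝ) : ℂ) + ((-(2 * u * w) : ℝ) : ℂ) * Complex.I := by
    push_cast
    ring
  have h2 : ‖(1 - 2 * u * w * Complex.I : ℂ)‖ = √(1 + 4 * u ^ 2 * w ^ 2) := by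
    rw [h1, Complex.norm_add_mul_I]
    congr 1
    ring
  have h3 : (u * w * Complex.I : ℂ).re = 0 := by simp
  have h4 : (-(1 / 2) : ℂ) = ((-(1 / 2) : ℝ) : ℂ) := by push_cast; ring
  rw [logFactor, Complex.sub_re, h3, h4, Complex.re_ofReal_mul, Complex.log_re, h2,
    Real.log_sqrt (by positivity)]
  ring

/-- Decay of one factor of the characteristic function: this is `log (1 + y) ≥ y / 2` on `[0, 1]`,
at `y = 4 min (u², 1) w²`. -/
lemma re_logFactor_le {w : ℝ} (hw : 0 ≤ w) (hw' : w ≤ 1 / 2) (u : ℝ) :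
    (logFactor w u).re ≤ -(1 / 2 * min (u ^ 2) 1) * w ^ 2 := by
  set m := min (u ^ 2) 1 with hm
  have hm0 : 0 ≤ m := le_min (sq_nonneg u) zero_le_one
  have hm1 : m ≤ 1 := min_le_right _ _
  have hmu : m ≤ u ^ 2 := min_le_left _ _
  have hw2 : w ^ 2 ≤ 1 / 4 := by nlinarith
  have hy0 : 0 ≤ 4 * m * w ^ 2 := by positivity
  have hy1 : 4 * m * w ^ 2 ≤ 1 := by nlinarith [sq_nonneg w]
  have h1 : Real.log (1 + 4 * m * w ^ 2) ≤ Real.log (1 + 4 * u ^ 2 * w ^ 2) := by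
    gcongr
  have h2 := Real.one_sub_inv_le_log_of_pos (x := 1 + 4 * m * w ^ 2) (by positivity)
  have h3 : 2 * m * w ^ 2 ≤ 1 - (1 + 4 * m * w ^ 2)⁻¹ := by
    rw [le_sub_iff_add_le, ← le_sub_iff_add_le', inv_le_iff_one_le_mul₀ (by positivity)]
    nlinarith
  rw [re_logFactor]
  nlinarith

/-- Second order expansion of one factor at `u = 0`. One power of `w` is spent on the bound
`w ≤ 1 / 2`, so that the errors are summable against `∑ w²`. -/
lemma norm_logFactor_add_le {w u : ℝ} (hw : 0 ≤ w) (hw' : w ≤ 1 / 2) (hu : |u| ≤ 1 / 2) :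
    ‖logFactor w u + ((u ^ 2 * w ^ 2 : ℝ) : ℂ)‖ ≤ 3 / 2 * |u| ^ 3 * w ^ 2 := by
  set y : ℂ := -(2 * u * w * Complex.I) with hy
  have hyn : ‖y‖ = 2 * |u| * w := by
    rw [hy, norm_neg, norm_mul, Complex.norm_I, mul_one, norm_mul, norm_mul, Complex.norm_real,
      Complex.norm_real, Real.norm_eq_abs, Real.norm_eq_abs, abs_of_nonneg hw]
    simp
  have hyle : ‖y‖ ≤ 1 / 2 := by
    rw [hyn]
    nlinarith [abs_nonneg u]
  have h := Complex.norm_log_sub_logTaylor_le 2 (z := y) (by linarith)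
  have heq : logFactor w u + ((u ^ 2 * w ^ 2 : ℝ) : ℂ)
      = -(1 / 2) * (Complex.log (1 + y) - Complex.logTaylor (2 + 1) y) := by
    have hT : Complex.logTaylor (2 + 1) y = y - y ^ 2 / 2 := by
      simp only [Complex.logTaylor, Finset.sum_range_succ, Finset.sum_range_zero]
      push_cast
      ring
    rw [hT, logFactor, sub_eq_add_neg 1, ← hy, show y ^ 2 = -4 * u ^ 2 * w ^ 2 by
      rw [hy, neg_sq, mul_pow, Complex.I_sq]; ring]
    rw [show (u * w * Complex.I : ℂ) = -y / 2 by rw [hy]; ring]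
    push_cast
    ring
  have hinv : (1 - ‖y‖)⁻¹ ≤ 2 := by
    rw [inv_le_comm₀ (by linarith) two_pos]
    linarith
  have hhalf : ‖(-(1 / 2) : ℂ)‖ = 1 / 2 := by norm_num
  rw [heq, norm_mul, hhalf]
  have h' : ‖y‖ ^ (2 + 1) * (1 - ‖y‖)⁻¹ ≤ ‖y‖ ^ (2 + 1) * 2 := by gcongr
  have hp : 0 ≤ |u| ^ 3 * w ^ 2 := by positivity
  calc 1 / 2 * ‖Complex.log (1 + y) - Complex.logTaylor (2 + 1) y‖
      ≤ 1 / 2 * (‖y‖ ^ (2 + 1) * 2 / ((2 : ℕ) + 1)) := by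
        refine mul_le_mul_of_nonneg_left (h.trans ?_) (by norm_num)
        gcongr
    _ = 8 / 3 * (|u| ^ 3 * w ^ 2) * w := by
        rw [hyn]
        push_cast
        ring
    _ ≤ _ := by nlinarith

variable {w : ℕ → ℝ} {u : ℝ} {φ : ℂ}

lemma norm_le_of_tendsto_exp_sum_logFactor (hw : ∀ i, 0 ≤ w i) (hw' : ∀ i, w i ≤ 1 / 2)
    (hsum : Summable fun i => w i ^ 2)
    (hφ : Tendsto (fun n => Complex.exp (∑ i ∈ Finset.range n, logFactor (w i) u)) atTop (𝓝 φ)) :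
    ‖φ‖ ≤ Real.exp (-(1 / 2 * min (u ^ 2) 1) * ∑' i, w i ^ 2) := by
  have h1 : Tendsto (fun n => Real.exp (-(1 / 2 * min (u ^ 2) 1) * ∑ i ∈ Finset.range n, w i ^ 2))
      atTop (𝓝 (Real.exp (-(1 / 2 * min (u ^ 2) 1) * ∑' i, w i ^ 2))) :=
    (Real.continuous_exp.tendsto _).comp (hsum.hasSum.tendsto_sum_nat.const_mul _)
  refine le_of_tendsto_of_tendsto' hφ.norm h1 fun n => ?_
  rw [Complex.norm_exp, Complex.re_sum, Finset.mul_sum, Real.exp_le_exp]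
  exact Finset.sum_le_sum fun i _ => re_logFactor_le (hw i) (hw' i) u

lemma norm_mul_exp_sub_one_le_of_tendsto (hw : ∀ i, 0 ≤ w i) (hw' : ∀ i, w i ≤ 1 / 2)
    (hsum : Summable fun i => w i ^ 2) (hu : |u| ≤ 1 / 2)
    (hsmall : 3 / 2 * |u| ^ 3 * ∑' i, w i ^ 2 ≤ 1)
    (hφ : Tendsto (fun n => Complex.exp (∑ i ∈ Finset.range n, logFactor (w i) u)) atTop (𝓝 φ)) :
    ‖φ * Real.exp (u ^ 2 * ∑' i, w i ^ 2) - 1‖ ≤ 2 * (3 / 2 * |u| ^ 3 * ∑' i, w i ^ 2) := by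
  have h1 : Tendsto (fun n => Real.exp (u ^ 2 * ∑ i ∈ Finset.range n, w i ^ 2))
      atTop (𝓝 (Real.exp (u ^ 2 * ∑' i, w i ^ 2))) :=
    (Real.continuous_exp.tendsto _).comp (hsum.hasSum.tendsto_sum_nat.const_mul _)
  have h2 := (hφ.mul ((Complex.continuous_ofReal.tendsto _).comp h1)).sub_const 1
  refine le_of_tendsto' h2.norm fun n => ?_
  set E : ℂ := ∑ i ∈ Finset.range n, (logFactor (w i) u + ((u ^ 2 * w i ^ 2 : ℝ) : ℂ)) with hE
  have hEle : ‖E‖ ≤ 3 / 2 * |u| ^ 3 * ∑' i, w i ^ 2 := by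
    calc ‖E‖ ≤ ∑ i ∈ Finset.range n, 3 / 2 * |u| ^ 3 * w i ^ 2 :=
          norm_sum_le_of_le _ fun i _ => norm_logFactor_add_le (hw i) (hw' i) hu
      _ = 3 / 2 * |u| ^ 3 * ∑ i ∈ Finset.range n, w i ^ 2 := (Finset.mul_sum _ _ _).symm
      _ ≤ _ := by
          gcongr
          exact hsum.sum_le_tsum _ fun i _ => sq_nonneg _
  have hexp : Complex.exp (∑ i ∈ Finset.range n, logFactor (w i) u) *
      ((Complex.ofReal ∘ fun n => Real.exp (u ^ 2 * ∑ i ∈ Finset.range n, w i ^ 2)) n)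
      = Complex.exp E := by
    rw [Function.comp, Complex.ofReal_exp, ← Complex.exp_add, hE, Finset.sum_add_distrib,
      Finset.mul_sum, Complex.ofReal_sum]
  rw [hexp]
  exact (Complex.norm_exp_sub_one_le (hEle.trans hsmall)).trans (by linarith)

variable {a : ℕ → ℝ}

/-- Under the measure tilted by `exp (-θ z)`, the variable `θ (z - μ(θ))` is distributed as
`∑ wᵢ (ξᵢ² - 1)`, with `ξᵢ` independent standard normal variables and these weights `wᵢ`. -/
noncomputable def weight (a : ℕ → ℝ) (θ : ℝ) (i : ℕ) : ℝ := θ / (a i ^ 2 + 2 * θ)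

/-- The standard deviation of `∑ wᵢ (ξᵢ² - 1)`, for `w = weight a θ`. -/
noncomputable def spread (a : ℕ → ℝ) (θ : ℝ) : ℝ := √(2 * ∑' i, weight a θ i ^ 2)

lemma weight_nonneg {θ : ℝ} (hθ : 0 ≤ θ) (i : ℕ) : 0 ≤ weight a θ i := by
  unfold weight
  positivity

lemma weight_le (ha0 : ∀ i, a i ≠ 0) {θ : ℝ} (hθ : 0 ≤ θ) (i : ℕ) : weight a θ i ≤ 1 / 2 := by
  rw [weight, div_le_iff₀ (add_two_mul_pos ha0 hθ i)]
  nlinarith [sq_nonneg (a i)]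

lemma hasSum_weight (ha0 : ∀ i, a i ≠ 0) (hsum : Summable fun i => 1 / a i ^ 2) {θ : ℝ}
    (hθ : 0 ≤ θ) : HasSum (weight a θ) (θ * mu a θ) := by
  have := (summable_mu ha0 hsum hθ).hasSum.mul_left θ
  simp only [mul_one_div] at this
  exact this

lemma summable_weight_sq (ha0 : ∀ i, a i ≠ 0) (hsum : Summable fun i => 1 / a i ^ 2) {θ : ℝ}
    (hθ : 0 ≤ θ) : Summable fun i => weight a θ i ^ 2 := by
  refine (hasSum_weight ha0 hsum hθ).summable.of_nonneg_of_le (fun i => sq_nonneg _) fun i => ?_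
  nlinarith [weight_nonneg (a := a) hθ i, weight_le ha0 hθ i]

lemma spread_sq (θ : ℝ) : spread a θ ^ 2 = 2 * ∑' i, weight a θ i ^ 2 :=
  Real.sq_sqrt (mul_nonneg zero_le_two (tsum_nonneg fun _ => sq_nonneg _))

lemma tendsto_weight (i : ℕ) : Tendsto (fun θ => weight a θ i) atTop (𝓝 (1 / 2)) := by
  have h : Tendsto (fun θ : ℝ => (a i ^ 2 * θ⁻¹ + 2)⁻¹) atTop (𝓝 ((a i ^ 2 * 0 + 2)⁻¹)) :=
    ((tendsto_inv_atTop_zero.const_mul _).add_const 2).inv₀ (by norm_num)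
  rw [show (a i ^ 2 * 0 + 2)⁻¹ = (1 / 2 : ℝ) by norm_num] at h
  refine h.congr' ?_
  filter_upwards [eventually_gt_atTop 0] with θ hθ
  have : 0 < a i ^ 2 + 2 * θ := by positivity
  rw [weight]
  field_simp

lemma tendsto_spread (ha0 : ∀ i, a i ≠ 0) (hsum : Summable fun i => 1 / a i ^ 2) :
    Tendsto (spread a) atTop atTop := by
  refine Real.tendsto_sqrt_atTop.comp (tendsto_atTop.2 fun b => ?_)
  obtain ⟨n, hn⟩ := exists_nat_gt (2 * b)
  -- `n` of the weights, each tending to `1 / 2`, already contribute `n / 2 > b`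
  have h : Tendsto (fun θ => 2 * ∑ i ∈ Finset.range n, weight a θ i ^ 2) atTop
      (𝓝 (2 * ∑ i ∈ Finset.range n, (1 / 2) ^ 2)) :=
    (tendsto_finsetSum _ fun i _ => (tendsto_weight i).pow 2).const_mul 2
  have hb : b < 2 * ∑ i ∈ Finset.range n, (1 / 2 : ℝ) ^ 2 := by
    simp only [Finset.sum_const, Finset.card_range, nsmul_eq_mul]
    linarith
  filter_upwards [h.eventually_const_lt hb, eventually_ge_atTop 0] with θ hθ hθ0
  refine hθ.le.trans (mul_le_mul_of_nonneg_left ?_ zero_le_two)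
  exact (summable_weight_sq ha0 hsum hθ0).sum_le_tsum _ fun i _ => sq_nonneg _

end

/-! ### The small ball probability under exponential tilting -/

section

/-- The square of a standard normal variable is Gamma distributed; this is its Laplace transform,
written as an exponential so that products over `i` become sums of logarithms. -/
lemma integral_cexp_neg_mul_sq_gaussianReal {c : ℂ} (hc : 0 ≤ c.re) :
    ∫ t : ℝ, Complex.exp (-c * (t : ℂ) ^ 2) ∂(gaussianReal 0 1)
      = Complex.exp (-(1 / 2) * Complex.log (1 + 2 * c)) := by
  have hb : 0 < (1 / 2 + c).re := by
    have : (1 / 2 + c).re = 1 / 2 + c.re := by simp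
    rw [this]
    positivity
  have hre : 0 < (1 + 2 * c).re := by
    have : (1 + 2 * c).re = 1 + 2 * c.re := by simp
    rw [this]
    positivity
  have hne : (1 + 2 * c) ≠ 0 := fun h => by simp [h] at hre
  have harg : (1 + 2 * c).arg ≠ Real.pi := fun h => by
    rw [Complex.arg_eq_pi_iff] at h
    exact absurd h.1 (not_lt.2 hre.le)
  have hfac : (Real.pi / (1 / 2 + c) : ℂ) = ((2 * Real.pi : ℝ) : ℂ) * (1 + 2 * c)⁻¹ := by
    rw [show (1 / 2 + c) = (1 + 2 * c) / 2 by ring]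
    push_cast
    field_simp
  have hne' : (Real.pi / (1 / 2 + c) : ℂ) ≠ 0 := by
    rw [hfac]
    refine mul_ne_zero ?_ (inv_ne_zero hne)
    exact_mod_cast (by positivity : (2 * Real.pi) ≠ 0)
  have hsqrt : (√(2 * Real.pi))⁻¹ = Real.exp (-(1 / 2) * Real.log (2 * Real.pi)) := by
    rw [Real.sqrt_eq_rpow, Real.rpow_def_of_pos (by positivity), ← Real.exp_neg]
    congr 1
    ring
  rw [integral_gaussianReal_eq_integral_smul one_ne_zero]
  calc _ = ((√(2 * Real.pi))⁻¹ : ℝ) * ∫ t : ℝ, Complex.exp (-(1 / 2 + c) * (t : ℂ) ^ 2) := by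
        rw [← integral_const_mul]
        congr 1 with t
        rw [gaussianPDFReal, Complex.real_smul]
        simp only [NNReal.coe_one, mul_one, sub_zero]
        rw [Complex.ofReal_mul, mul_assoc, Complex.ofReal_exp, ← Complex.exp_add]
        congr 2
        push_cast
        ring
    _ = _ := by
        rw [integral_gaussian_complex hb, Complex.cpow_def_of_ne_zero hne', hfac,
          Complex.log_ofReal_mul (by positivity) (inv_ne_zero hne), Complex.log_inv _ harg,
          hsqrt, Complex.ofReal_exp, ← Complex.exp_add]
        congr 1
        push_cast
        ring

lemma z_nonneg {Ω : Type*} (a : ℕ → ℝ) (X : ℕ → Ω → ℝ) (ω : Ω) : 0 ≤ z a X ω :=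
  tsum_nonneg fun _ => by positivity

variable {Ω : Type*} [MeasurableSpace Ω] {P : Measure Ω} {a : ℕ → ℝ} {X : ℕ → Ω → ℝ}

lemma aemeasurable_z (a : ℕ → ℝ) (hX : ∀ i, AEMeasurable (X i) P) : AEMeasurable (z a X) P := by
  refine AEMeasurable.tsum fun i => ?_
  have := hX i
  fun_prop

lemma lintegral_sq_gaussianReal : ∫⁻ t : ℝ, ENNReal.ofReal (t ^ 2) ∂(gaussianReal 0 1) = 1 := by
  have hint : Integrable (fun t : ℝ => t ^ 2) (gaussianReal 0 1) :=
    (memLp_id_gaussianReal (μ := 0) (v := 1) 2).integrable_sq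
  rw [← ofReal_integral_eq_lintegral_ofReal hint (ae_of_all _ fun t => sq_nonneg t)]
  have h := variance_fun_id_gaussianReal (μ := 0) (v := 1)
  rw [variance_of_integral_eq_zero (by fun_prop) integral_id_gaussianReal] at h
  rw [h]
  simp

lemma ae_summable (hsum : Summable fun i => 1 / a i ^ 2)
    (hlaw : ∀ i, HasLaw (X i) (gaussianReal 0 1) P) :
    ∀ᵐ ω ∂P, Summable fun i => X i ω ^ 2 / a i ^ 2 := by
  have hmeas : ∀ i, AEMeasurable (fun ω => ENNReal.ofReal (X i ω ^ 2 / a i ^ 2)) P := fun i => by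
    have := (hlaw i).aemeasurable
    fun_prop
  have hfin : ∫⁻ ω, ∑' i, ENNReal.ofReal (X i ω ^ 2 / a i ^ 2) ∂P ≠ ∞ := by
    have hterm : ∀ i, ∫⁻ ω, ENNReal.ofReal (X i ω ^ 2 / a i ^ 2) ∂P
        = ENNReal.ofReal (1 / a i ^ 2) := by
      intro i
      have hmul : ∀ t : ℝ, ENNReal.ofReal (t ^ 2 / a i ^ 2)
          = ENNReal.ofReal (1 / a i ^ 2) * ENNReal.ofReal (t ^ 2) := fun t => by
        rw [← ENNReal.ofReal_mul (by positivity), one_div_mul_eq_div]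
      rw [(hlaw i).lintegral_comp (f := fun t => ENNReal.ofReal (t ^ 2 / a i ^ 2))
        (Measurable.aemeasurable (by fun_prop))]
      simp_rw [hmul]
      rw [lintegral_const_mul _ (by fun_prop), lintegral_sq_gaussianReal, mul_one]
    rw [lintegral_tsum hmeas]
    simp_rw [hterm]
    exact hsum.tsum_ofReal_ne_top
  filter_upwards [ae_lt_top' (AEMeasurable.tsum hmeas) hfin] with ω hω
  refine (ENNReal.summable_toReal hω.ne).congr fun i => ?_
  rw [ENNReal.toReal_ofReal (by positivity)]

lemma integral_cexp_neg_mul_sum (hlaw : ∀ i, HasLaw (X i) (gaussianReal 0 1) P)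
    (hindep : iIndepFun X P) {ζ : ℂ} (hζ : 0 ≤ ζ.re) (n : ℕ) :
    ∫ ω, Complex.exp (-ζ * ((∑ i ∈ Finset.range n, X i ω ^ 2 / a i ^ 2 : ℝ) : ℂ)) ∂P
      = Complex.exp (∑ i ∈ Finset.range n,
        -(1 / 2) * Complex.log (1 + 2 * (ζ / (a i : ℂ) ^ 2))) := by
  have hfin := hindep.precomp (g := fun i : Fin n => (i : ℕ)) Fin.val_injective
  have h := hfin.integral_fun_prod_comp
    (f := fun (i : Fin n) (t : ℝ) => Complex.exp (-(ζ / (a i : ℂ) ^ 2) * (t : ℂ) ^ 2))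
    (fun i => (hlaw i).aemeasurable) (fun i => Continuous.aestronglyMeasurable (by fun_prop))
  rw [Complex.exp_sum, ← Fin.prod_univ_eq_prod_range
    (fun i => Complex.exp (-(1 / 2) * Complex.log (1 + 2 * (ζ / (a i : ℂ) ^ 2))))]
  convert h using 1
  · congr 1 with ω
    rw [← Complex.exp_sum, Fin.sum_univ_eq_sum_range
      (fun i => -(ζ / (a i : ℂ) ^ 2) * (X i ω : ℂ) ^ 2)]
    push_cast
    rw [Finset.mul_sum]
    congr 1
    exact Finset.sum_congr rfl fun i _ => by ring
  · refine Finset.prod_congr rfl fun i _ => ?_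
    have hre : 0 ≤ (ζ / (a i : ℂ) ^ 2).re := by
      rw [← Complex.ofReal_pow, Complex.div_ofReal_re]
      positivity
    rw [← integral_cexp_neg_mul_sq_gaussianReal hre, ← (hlaw i).integral_comp
      (f := fun t : ℝ => Complex.exp (-(ζ / (a i : ℂ) ^ 2) * (t : ℂ) ^ 2))
      (Continuous.aestronglyMeasurable (by fun_prop))]
    rfl

lemma norm_cexp_neg_mul_le_one {ζ : ℂ} (hζ : 0 ≤ ζ.re) {t : ℝ} (ht : 0 ≤ t) :
    ‖Complex.exp (-ζ * (t : ℂ))‖ ≤ 1 := by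
  rw [Complex.norm_exp, Real.exp_le_one_iff, Complex.re_mul_ofReal, Complex.neg_re]
  nlinarith

lemma tendsto_integral_cexp_neg_mul_z [IsProbabilityMeasure P]
    (hsum : Summable fun i => 1 / a i ^ 2)
    (hlaw : ∀ i, HasLaw (X i) (gaussianReal 0 1) P) (hindep : iIndepFun X P) {ζ : ℂ}
    (hζ : 0 ≤ ζ.re) :
    Tendsto (fun n => Complex.exp (∑ i ∈ Finset.range n,
        -(1 / 2) * Complex.log (1 + 2 * (ζ / (a i : ℂ) ^ 2)))) atTop
      (𝓝 (∫ ω, Complex.exp (-ζ * (z a X ω : ℂ)) ∂P)) := by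
  simp_rw [← integral_cexp_neg_mul_sum hlaw hindep hζ]
  refine tendsto_integral_of_dominated_convergence (fun _ => 1) (fun n => ?_)
    (integrable_const _) (fun n => ae_of_all _ fun ω => norm_cexp_neg_mul_le_one hζ
      (Finset.sum_nonneg fun i _ => by positivity)) ?_
  · have h : AEMeasurable (fun ω => ∑ i ∈ Finset.range n, X i ω ^ 2 / a i ^ 2) P :=
      Finset.aemeasurable_fun_sum _ fun i _ => ((hlaw i).aemeasurable.pow_const 2).div_const _
    exact AEMeasurable.aestronglyMeasurable (by fun_prop)
  · filter_upwards [ae_summable hsum hlaw] with ω hω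
    have hc : Continuous fun t : ℝ => Complex.exp (-ζ * (t : ℂ)) := by fun_prop
    exact (hc.tendsto _).comp hω.hasSum.tendsto_sum_nat

/-- The law of `θ (z - μ(θ))` under the measure `P` tilted by `exp (-θ z)`. -/
noncomputable def tiltedLaw (P : Measure Ω) (a : ℕ → ℝ) (X : ℕ → Ω → ℝ) (θ : ℝ) : Measure ℝ :=
  (P.tilted fun ω => -θ * z a X ω).map fun ω => θ * (z a X ω - mu a θ)

lemma integrable_exp_neg_mul_z [IsProbabilityMeasure P] (hX : ∀ i, AEMeasurable (X i) P) {θ : ℝ}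
    (hθ : 0 ≤ θ) : Integrable (fun ω => Real.exp (-θ * z a X ω)) P := by
  have := aemeasurable_z a hX
  refine Integrable.of_bound (AEMeasurable.aestronglyMeasurable (by fun_prop)) 1
    (ae_of_all _ fun ω => ?_)
  rw [Real.norm_eq_abs, Real.abs_exp, Real.exp_le_one_iff]
  nlinarith [z_nonneg a X ω]

lemma isProbabilityMeasure_tiltedLaw [IsProbabilityMeasure P] (hX : ∀ i, AEMeasurable (X i) P)
    {θ : ℝ} (hθ : 0 ≤ θ) : IsProbabilityMeasure (tiltedLaw P a X θ) := by
  have := isProbabilityMeasure_tilted (integrable_exp_neg_mul_z (a := a) hX hθ)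
  refine Measure.isProbabilityMeasure_map ?_
  exact (((aemeasurable_z a hX).mono_ac (tilted_absolutelyContinuous _ _)).sub_const _).const_mul _

/-- The characteristic function of `tiltedLaw` is `exp (-i u θ μ(θ)) L(θ (1 - i u)) / L(θ)` with
`L` the Laplace transform of `z`, and each of the three terms is an infinite product over `i`. -/
lemma tendsto_charFun_tiltedLaw [IsProbabilityMeasure P] (ha0 : ∀ i, a i ≠ 0)
    (hsum : Summable fun i => 1 / a i ^ 2)
    (hlaw : ∀ i, HasLaw (X i) (gaussianReal 0 1) P) (hindep : iIndepFun X P) {θ : ℝ}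
    (hθ : 0 ≤ θ) (u : ℝ) :
    Tendsto (fun n => Complex.exp (∑ i ∈ Finset.range n, logFactor (weight a θ i) u)) atTop
      (𝓝 (charFun (tiltedLaw P a X θ) u)) := by
  have hX : ∀ i, AEMeasurable (X i) P := fun i => (hlaw i).aemeasurable
  set ζ : ℂ := θ * (1 - u * Complex.I) with hζ
  have hζre : ζ.re = θ := by simp [hζ]
  have hN := tendsto_integral_cexp_neg_mul_z hsum hlaw hindep (ζ := ζ) (hζre.symm ▸ hθ)
  have hD := tendsto_integral_cexp_neg_mul_z hsum hlaw hindep (ζ := (θ : ℂ)) (by simpa using hθ)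
  have hM : Tendsto (fun n => Complex.exp (-(u * Complex.I) *
      ((∑ i ∈ Finset.range n, weight a θ i : ℝ) : ℂ))) atTop
      (𝓝 (Complex.exp (-(u * Complex.I) * ((θ * mu a θ : ℝ) : ℂ)))) := by
    have hc : Continuous fun t : ℝ => Complex.exp (-(u * Complex.I) * (t : ℂ)) := by fun_prop
    exact (hc.tendsto _).comp (hasSum_weight ha0 hsum hθ).tendsto_sum_nat
  have hL : ∫ ω, Complex.exp (-(θ : ℂ) * (z a X ω : ℂ)) ∂P
      = ((∫ ω, Real.exp (-θ * z a X ω) ∂P : ℝ) : ℂ) := by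
    rw [← integral_complex_ofReal]
    congr 1 with ω
    push_cast
    rfl
  have hLpos := integral_exp_pos (integrable_exp_neg_mul_z (a := a) hX hθ)
  have hLne : ∫ ω, Complex.exp (-(θ : ℂ) * (z a X ω : ℂ)) ∂P ≠ 0 := by
    rw [hL]
    exact_mod_cast hLpos.ne'
  have hlimit : charFun (tiltedLaw P a X θ) u
      = Complex.exp (-(u * Complex.I) * ((θ * mu a θ : ℝ) : ℂ)) *
        ((∫ ω, Complex.exp (-ζ * (z a X ω : ℂ)) ∂P) /
          ∫ ω, Complex.exp (-(θ : ℂ) * (z a X ω : ℂ)) ∂P) := by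
    rw [charFun_apply_real, tiltedLaw, integral_map
      ((((aemeasurable_z a hX).mono_ac (tilted_absolutelyContinuous _ _)).sub_const _).const_mul _)
      (Continuous.aestronglyMeasurable (by fun_prop)), integral_tilted, hL, div_eq_inv_mul,
      ← mul_assoc, ← integral_const_mul]
    congr 1 with ω
    have hexp : Complex.exp ((-θ * z a X ω : ℝ) : ℂ) *
        Complex.exp (u * ((θ * (z a X ω - mu a θ) : ℝ) : ℂ) * Complex.I)
        = Complex.exp (-(u * Complex.I) * ((θ * mu a θ : ℝ) : ℂ)) *
          Complex.exp (-ζ * (z a X ω : ℂ)) := by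
      rw [← Complex.exp_add, ← Complex.exp_add, hζ]
      congr 1
      push_cast
      ring
    rw [Complex.real_smul, Complex.ofReal_div, Complex.ofReal_exp, div_eq_inv_mul]
    linear_combination ((∫ ω, Real.exp (-θ * z a X ω) ∂P : ℝ) : ℂ)⁻¹ * hexp
  rw [hlimit]
  refine (hM.mul (hN.div hD hLne)).congr fun n => ?_
  rw [Pi.div_apply, ← Complex.exp_sub, ← Complex.exp_add, ← Finset.sum_sub_distrib,
    Complex.ofReal_sum, Finset.mul_sum, ← Finset.sum_add_distrib]
  congr 1
  refine Finset.sum_congr rfl fun i _ => ?_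
  have hai : (a i : ℂ) ≠ 0 := by exact_mod_cast ha0 i
  have hden := add_two_mul_pos ha0 hθ i
  have hden' : ((a i : ℂ) ^ 2 + 2 * θ) ≠ 0 := by exact_mod_cast hden.ne'
  have hpos : 0 < 1 + 2 * (θ / a i ^ 2) := by positivity
  have hne : (1 - 2 * u * (weight a θ i : ℂ) * Complex.I) ≠ 0 := fun h => by
    have := congrArg Complex.re h
    simp at this
  -- the positive factor `1 + 2θ / a_i²` splits off the complex logarithm and cancels against `L(θ)`
  have h1 : (1 + 2 * (ζ / (a i : ℂ) ^ 2)) = ((1 + 2 * (θ / a i ^ 2) : ℝ) : ℂ) *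
      (1 - 2 * u * (weight a θ i : ℂ) * Complex.I) := by
    rw [hζ, weight]
    push_cast
    field_simp
    ring
  have h2 : (1 + 2 * ((θ : ℂ) / (a i : ℂ) ^ 2)) = ((1 + 2 * (θ / a i ^ 2) : ℝ) : ℂ) := by
    push_cast
    rfl
  rw [h1, h2, Complex.log_ofReal_mul hpos hne, ← Complex.ofReal_log hpos.le, logFactor]
  ring

/-- Undoing the tilt: the small ball probability near `μ(θ)` as an integral against
`tiltedLaw`. -/
lemma smallBall_eq_setIntegral_tiltedLaw [IsProbabilityMeasure P] (hX : ∀ i, AEMeasurable (X i) P)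
    {θ : ℝ} (hθ : 0 < θ) (y : ℝ) :
    smallBall P a X (mu a θ + y * θ⁻¹) = (∫ ω, Real.exp (-θ * z a X ω) ∂P) *
      Real.exp (θ * mu a θ) * ∫ t in Iio y, Real.exp t ∂(tiltedLaw P a X θ) := by
  have hz := aemeasurable_z a hX
  have hLpos := integral_exp_pos (integrable_exp_neg_mul_z (a := a) hX hθ.le)
  have hset : NullMeasurableSet {ω | z a X ω < mu a θ + y * θ⁻¹} P :=
    nullMeasurableSet_lt hz aemeasurable_const
  have hP : P.real {ω | z a X ω < mu a θ + y * θ⁻¹}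
      = ∫ ω, {ω | z a X ω < mu a θ + y * θ⁻¹}.indicator (fun _ => (1 : ℝ)) ω ∂P := by
    rw [integral_indicator₀ hset]
    simp
  rw [← integral_indicator measurableSet_Iio, tiltedLaw, integral_map
      (((hz.mono_ac (tilted_absolutelyContinuous _ _)).sub_const _).const_mul _)
      ((Real.measurable_exp.indicator measurableSet_Iio).aestronglyMeasurable), integral_tilted,
      ← integral_const_mul, smallBall, hP]
  congr 1 with ω
  have hiff : θ * (z a X ω - mu a θ) ∈ Iio y ↔ ω ∈ {ω | z a X ω < mu a θ + y * θ⁻¹} := by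
    rw [mem_Iio, mem_ofPred_eq, ← lt_div_iff₀' hθ, div_eq_mul_inv, sub_lt_iff_lt_add']
  by_cases hω : ω ∈ {ω | z a X ω < mu a θ + y * θ⁻¹}
  · rw [indicator_of_mem hω, indicator_of_mem (hiff.2 hω), smul_eq_mul]
    have : Real.exp (θ * mu a θ) * (Real.exp (-θ * z a X ω) *
        Real.exp (θ * (z a X ω - mu a θ))) = 1 := by
      rw [← Real.exp_add, ← Real.exp_add, Real.exp_eq_one_iff]
      ring
    linear_combination -(1 / (∫ ω, Real.exp (-θ * z a X ω) ∂P)) *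
      (∫ ω, Real.exp (-θ * z a X ω) ∂P) * this - mul_inv_cancel₀ hLpos.ne'
  · rw [indicator_of_notMem hω, indicator_of_notMem (mt hiff.1 hω), smul_zero, mul_zero]

/-- The law of `z` has no atoms: conditionally on the other variables, `z = s` leaves at most two
values for `x_0`. -/
lemma measure_z_eq [IsProbabilityMeasure P] (ha0 : ∀ i, a i ≠ 0)
    (hsum : Summable fun i => 1 / a i ^ 2)
    (hlaw : ∀ i, HasLaw (X i) (gaussianReal 0 1) P) (hindep : iIndepFun X P) (s : ℝ) :
    P {ω | z a X ω = s} = 0 := by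
  have hX : ∀ i, AEMeasurable (X i) P := fun i => (hlaw i).aemeasurable
  set a' : ℕ → ℝ := fun i => a (i + 1)
  set R : Ω → ℝ := z a' (fun i => X (i + 1)) with hR
  have hRm : AEMeasurable R P := aemeasurable_z a' fun i => hX (i + 1)
  have hproc : IndepFun (X 0) (fun ω i => X (i + 1) ω) P := by
    refine IndepFun.indepFun_process₀ (hX 0) (fun i => hX (i + 1)) fun I => ?_
    have hdisj : Disjoint ({0} : Finset ℕ) (I.image (· + 1)) := by simp
    have h := hindep.indepFun_finset₀ _ _ hdisj hX
    have hφ : Measurable fun f : ({0} : Finset ℕ) → ℝ => f ⟨0, by simp⟩ := measurable_pi_apply _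
    have hψ : Measurable fun (f : (I.image (· + 1) : Finset ℕ) → ℝ) (i : I) =>
        f ⟨i + 1, Finset.mem_image_of_mem _ i.2⟩ :=
      measurable_pi_lambda _ fun i => measurable_pi_apply _
    exact h.comp hφ hψ
  have hind : IndepFun (X 0) R P := by
    have hψ : Measurable fun y : ℕ → ℝ => ∑' i, y i ^ 2 / a' i ^ 2 :=
      Measurable.tsum fun i => by fun_prop
    exact hproc.comp measurable_id hψ
  have hmap := (indepFun_iff_map_prod_eq_prod_map_map (hX 0) hRm).1 hind
  have hset : MeasurableSet {p : ℝ × ℝ | p.1 ^ 2 / a 0 ^ 2 + p.2 = s} :=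
    measurableSet_eq_fun (by fun_prop) (by fun_prop)
  have hnull : P {ω | X 0 ω ^ 2 / a 0 ^ 2 + R ω = s} = 0 := by
    have h1 : P {ω | X 0 ω ^ 2 / a 0 ^ 2 + R ω = s}
        = P.map (fun ω => (X 0 ω, R ω)) {p : ℝ × ℝ | p.1 ^ 2 / a 0 ^ 2 + p.2 = s} := by
      rw [Measure.map_apply_of_aemeasurable ((hX 0).prodMk hRm) hset]
      rfl
    have h2 : ∀ r, P.map (X 0) ((fun t => (t, r)) ⁻¹' {p : ℝ × ℝ | p.1 ^ 2 / a 0 ^ 2 + p.2 = s})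
        = 0 := by
      intro r
      have := nullSingletonClass_gaussianReal (μ := 0) (v := 1) one_ne_zero
      rw [(hlaw 0).map_eq]
      refine Set.Finite.measure_zero (((finite_singleton (-√(a 0 ^ 2 * (s - r)))).insert
        (√(a 0 ^ 2 * (s - r)))).subset fun t ht => ?_) _
      have ht' : t ^ 2 / a 0 ^ 2 + r = s := ht
      have hsq : a 0 ^ 2 * (s - r) = t ^ 2 := by
        have := ha0 0
        rw [← ht']
        field_simp
        ring
      rw [hsq, Real.sqrt_sq_eq_abs]
      rcases abs_choice t with h | h <;> simp [h]
    rw [h1, hmap, Measure.prod_apply_symm hset]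
    simp only [h2, lintegral_zero]
  refine measure_mono_null_ae ?_ hnull
  filter_upwards [ae_summable hsum hlaw] with ω hω h
  rw [← h]
  exact (hω.tsum_eq_zero_add).symm

end

/-! ### De Haan's class at zero -/

section

variable {Ω : Type*} [MeasurableSpace Ω] {P : Measure Ω} {a : ℕ → ℝ} {X : ℕ → Ω → ℝ}

lemma norm_charFun_tiltedLaw_le [IsProbabilityMeasure P] (ha0 : ∀ i, a i ≠ 0)
    (hsum : Summable fun i => 1 / a i ^ 2)
    (hlaw : ∀ i, HasLaw (X i) (gaussianReal 0 1) P) (hindep : iIndepFun X P) {θ : ℝ}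
    (hθ : 0 ≤ θ) (u : ℝ) :
    ‖charFun (tiltedLaw P a X θ) u‖ ≤ Real.exp (-(1 / 4 * spread a θ ^ 2 * min (u ^ 2) 1)) := by
  refine (norm_le_of_tendsto_exp_sum_logFactor (weight_nonneg hθ) (weight_le ha0 hθ)
    (summable_weight_sq ha0 hsum hθ)
    (tendsto_charFun_tiltedLaw ha0 hsum hlaw hindep hθ u)).trans_eq ?_
  rw [spread_sq]
  congr 1
  ring

lemma tendsto_charFun_tiltedLaw_div_spread [IsProbabilityMeasure P] (ha0 : ∀ i, a i ≠ 0)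
    (hsum : Summable fun i => 1 / a i ^ 2)
    (hlaw : ∀ i, HasLaw (X i) (gaussianReal 0 1) P) (hindep : iIndepFun X P) (v : ℝ) :
    Tendsto (fun θ => charFun (tiltedLaw P a X θ) (v / spread a θ)) atTop
      (𝓝 (Real.exp (-(v ^ 2) / 2))) := by
  have hτ := tendsto_spread ha0 hsum
  have hsmall : Tendsto (fun θ => 3 / 4 * |v| ^ 3 / spread a θ) atTop (𝓝 0) :=
    hτ.const_div_atTop _
  have hu : Tendsto (fun θ => |v| / spread a θ) atTop (𝓝 0) := hτ.const_div_atTop _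
  have hone : Tendsto (fun θ => charFun (tiltedLaw P a X θ) (v / spread a θ) *
      Real.exp (v ^ 2 / 2)) atTop (𝓝 1) := by
    rw [tendsto_iff_norm_sub_tendsto_zero]
    have h2 := hsmall.const_mul 2
    rw [mul_zero] at h2
    refine squeeze_zero' (Eventually.of_forall fun _ => norm_nonneg _) ?_ h2
    filter_upwards [hτ.eventually_gt_atTop 0, eventually_ge_atTop 0,
      hsmall.eventually_le_const zero_lt_one,
      hu.eventually_le_const (show (0 : ℝ) < 1 / 2 by norm_num)] with θ hpos hθ h1 h2
    have htsum : ∑' i, weight a θ i ^ 2 = spread a θ ^ 2 / 2 := by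
      rw [spread_sq]
      ring
    have habs : |v / spread a θ| = |v| / spread a θ := by rw [abs_div, abs_of_pos hpos]
    have herr : 3 / 2 * |v / spread a θ| ^ 3 * ∑' i, weight a θ i ^ 2
        = 3 / 4 * |v| ^ 3 / spread a θ := by
      rw [habs, htsum]
      field_simp
      norm_num [mul_comm]
    have hexp : (v / spread a θ) ^ 2 * ∑' i, weight a θ i ^ 2 = v ^ 2 / 2 := by
      rw [htsum]
      field_simp
    have h := norm_mul_exp_sub_one_le_of_tendsto (weight_nonneg hθ) (weight_le ha0 hθ)
      (summable_weight_sq ha0 hsum hθ) (habs.trans_le h2) (herr.trans_le h1)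
      (tendsto_charFun_tiltedLaw ha0 hsum hlaw hindep hθ _)
    rwa [herr, hexp] at h
  have h := hone.mul_const ((Real.exp (-(v ^ 2) / 2) : ℝ) : ℂ)
  rw [one_mul] at h
  refine h.congr fun θ => ?_
  rw [mul_assoc, ← Complex.ofReal_mul, ← Real.exp_add]
  ring_nf
  simp

/-- The defining limit of the class `Γ₀`, parametrized by the saddle point `θ` of `s = μ(θ)`. -/
lemma tendsto_smallBall_div [IsProbabilityMeasure P] (ha0 : ∀ i, a i ≠ 0)
    (hsum : Summable fun i => 1 / a i ^ 2)
    (hlaw : ∀ i, HasLaw (X i) (gaussianReal 0 1) P) (hindep : iIndepFun X P) (y : ℝ) :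
    Tendsto (fun θ => smallBall P a X (mu a θ + y * θ⁻¹) / smallBall P a X (mu a θ)) atTop
      (𝓝 (Real.exp y)) := by
  have hX : ∀ i, AEMeasurable (X i) P := fun i => (hlaw i).aemeasurable
  refine tendsto_of_seq_tendsto fun θ hθ => ?_
  -- the sequence is truncated from below so that every tilted law is a probability measure
  set η : ℕ → ℝ := fun n => max (θ n) 1 with hη
  have hη0 : ∀ n, 0 < η n := fun n => zero_lt_one.trans_le (le_max_right _ _)
  have hηlim : Tendsto η atTop atTop := tendsto_atTop_mono (fun n => le_max_left _ _) hθ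
  have := fun n => isProbabilityMeasure_tiltedLaw (a := a) hX (hη0 n).le
  have hlim := tendsto_setIntegral_exp_div (Q := fun n => tiltedLaw P a X (η n))
    ((tendsto_spread ha0 hsum).comp hηlim) (by norm_num : (0 : ℝ) < 1 / 4)
    (fun n u => norm_charFun_tiltedLaw_le ha0 hsum hlaw hindep (hη0 n).le u)
    (fun v => (tendsto_charFun_tiltedLaw_div_spread ha0 hsum hlaw hindep v).comp hηlim) y
  refine hlim.congr' ?_
  filter_upwards [hθ.eventually_ge_atTop 1] with n hn
  have hηn : η n = θ n := max_eq_left hn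
  have hpos : 0 < θ n := zero_lt_one.trans_le hn
  have h0 := smallBall_eq_setIntegral_tiltedLaw (a := a) hX hpos 0
  rw [zero_mul, add_zero] at h0
  have hne : (∫ ω, Real.exp (-θ n * z a X ω) ∂P) * Real.exp (θ n * mu a (θ n)) ≠ 0 :=
    (mul_pos (integral_exp_pos (integrable_exp_neg_mul_z hX hpos.le)) (Real.exp_pos _)).ne'
  rw [hηn, Function.comp_apply, smallBall_eq_setIntegral_tiltedLaw hX hpos y, h0,
    mul_div_mul_left _ _ hne]

lemma isAuxiliaryFunction_rho [IsProbabilityMeasure P] (ha0 : ∀ i, a i ≠ 0)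
    (hsum : Summable fun i => 1 / a i ^ 2)
    (hlaw : ∀ i, HasLaw (X i) (gaussianReal 0 1) P) (hindep : iIndepFun X P) :
    IsAuxiliaryFunction (smallBall P a X) (rho a) where
  regular := ⟨mu a 0, mu_pos ha0 hsum le_rfl, fun _ _ => ENNReal.toReal_nonneg,
    continuousOn_rho ha0 hsum, monotoneOn_rho ha0 hsum⟩
  map_zero := rho_zero ha0 hsum
  tendsto_div y := by
    refine ((tendsto_smallBall_div ha0 hsum hlaw hindep y).comp
      (tendsto_inv_rho ha0 hsum)).congr' ?_
    filter_upwards [mu_inv_rho ha0 hsum] with s hs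
    simp only [Function.comp, hs, inv_inv]

lemma monotone_smallBall [IsProbabilityMeasure P] : Monotone (smallBall P a X) := fun _ _ h =>
  measureReal_mono fun _ hω => lt_of_lt_of_le hω h

lemma smallBall_of_nonpos {s : ℝ} (hs : s ≤ 0) : smallBall P a X s = 0 := by
  have : {ω | z a X ω < s} = ∅ :=
    eq_empty_of_forall_notMem fun ω hω => absurd (lt_of_lt_of_le hω hs) (z_nonneg a X ω).not_gt
  rw [smallBall, this, measureReal_empty]

lemma continuousWithinAt_smallBall [IsProbabilityMeasure P] (ha0 : ∀ i, a i ≠ 0)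
    (hsum : Summable fun i => 1 / a i ^ 2)
    (hlaw : ∀ i, HasLaw (X i) (gaussianReal 0 1) P) (hindep : iIndepFun X P) (s : ℝ) :
    ContinuousWithinAt (smallBall P a X) (Ici s) s := by
  have hX : ∀ i, AEMeasurable (X i) P := fun i => (hlaw i).aemeasurable
  have := Measure.isProbabilityMeasure_map (aemeasurable_z a hX)
  -- without an atom at `s`, the function agrees at `s` with the right-continuous `P (z ≤ s)`
  have hlt : ∀ t, smallBall P a X t = cdf (P.map (z a X)) t := by
    intro t
    rw [cdf_eq_real, map_measureReal_apply_of_aemeasurable (aemeasurable_z a hX) measurableSet_Iic]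
    refine measureReal_congr ?_
    filter_upwards [measure_eq_zero_iff_ae_notMem.1 (measure_z_eq ha0 hsum hlaw hindep t)]
      with ω hω
    exact propext ⟨le_of_lt, fun h => lt_of_le_of_ne h hω⟩
  rw [show smallBall P a X = cdf (P.map (z a X)) from funext hlt]
  exact (cdf (P.map (z a X))).right_continuous s

end

end SmallBall

theorem theorem2 {Ω : Type*} [MeasurableSpace Ω] (P : MeasureTheory.Measure Ω)
    [MeasureTheory.IsProbabilityMeasure P] (a : ℕ → ℝ) (ha0 : ∀ i, a i ≠ 0) (hmono : Monotone a)
    (hsum : Summable fun i => 1 / a i ^ 2) (x : ℕ → Ω → ℝ)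
    (hlaw : ∀ i, ProbabilityTheory.HasLaw (x i) (ProbabilityTheory.gaussianReal 0 1) P)
    (hindep : ProbabilityTheory.iIndepFun x P) :
    (∀ᵐ ω ∂P, Summable fun i => x i ω ^ 2 / a i ^ 2) ∧
      SmallBall.IsGammaZero (SmallBall.smallBall P a x) ∧
      SmallBall.IsAuxiliaryFunction (SmallBall.smallBall P a x) (SmallBall.rho a) := by
  have haux := SmallBall.isAuxiliaryFunction_rho ha0 hsum hlaw hindep
  exact ⟨SmallBall.ae_summable hsum hlaw,
    { nonneg := fun _ => measureReal_nonneg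
      null := fun _ => SmallBall.smallBall_of_nonpos
      mono := SmallBall.monotone_smallBall
      right_continuous := SmallBall.continuousWithinAt_smallBall ha0 hsum hlaw hindep
      exists_auxiliary := ⟨_, haux⟩ }, haux⟩
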